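/- Let $G$ be a finite simple graph that is $(P_5,C_4)$-free, i.e. no induced subgraph of $G$ is isomorphic to the path $P_5$ on five vertices or to the cycle $C_4$ on four vertices. Let $\chi(G)$ be the chromatic number of $G$. Then $G$ is $\ell$-mixing for every integer $\ell\ge\chi(G)+1$: the reconfiguration graph $\mathcal R_\ell(G)$, whose vertices are the proper colourings of $G$ with colours from $\{1,\dots,\ell\}$ and in which two colourings are adjacent exactly when they differ in colour on exactly one vertex, is connected. -/

import Mathlib

/-- `G` is `H`-free: no induced subgraph of `G` is isomorphic to `H`. -/
def IsInducedFree {V W : Type*} (H : SimpleGraph W) (G : SimpleGraph V) : Prop :=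
  ¬ H.IsIndContained G

/-- The reconfiguration graph of the `k`-colourings of `G`: its vertices are the proper colourings
of `G` with `k` colours, and two of them are adjacent if they differ on exactly one vertex. -/
def reconfigurationGraph {V : Type*} (G : SimpleGraph V) (k : ℕ) :
    SimpleGraph (G.Coloring (Fin k)) where
  Adj α β := ∃! v, α v ≠ β v
  symm := ⟨by
    rintro α β ⟨v, hv, h⟩
    exact ⟨v, Ne.symm hv, fun w hw => h w (Ne.symm hw)⟩⟩
  loopless := ⟨by
    rintro α ⟨v, hv, _⟩
    exact hv rfl⟩

/-- `G` is `k`-mixing: the reconfiguration graph of its `k`-colourings is connected. -/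
def IsMixing {V : Type*} (G : SimpleGraph V) (k : ℕ) : Prop :=
  (reconfigurationGraph G k).Connected

/-! Every nonempty induced subgraph `G[W]` of a (P₅,C₄)-free graph contains a nonempty homogeneous
set `M` without three pairwise nonadjacent vertices, whose neighbourhood `B` in `W \ M` is a clique
(`exists_isCliqueModule`). If `W` contains an induced five-cycle, `M` consists of the twins of its
vertices. If `W` is a clique, `M = W`. Otherwise a maximality argument yields a smaller module with
clique neighbourhood, and one recurses into it.

Mixing follows by induction on `W`, deleting `M` (`IsCliqueModule.mix`). A recolouring of `W \ M`
conflicts with `M` only when a vertex of `B` receives a colour `q`. The `#B` colours of `B` are all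
distinct and absent from `M`, so `M` keeps more colours than it needs and can first be recoloured to
avoid `q`. This uses that `G[M]` is itself mixing.

For `G[M]`, colour classes have at most two vertices. Given a target colouring that misses a colour,
one of its classes can be created in the other colouring; deleting this class and its colour gives
an induction (`reach_of_noIndepTriple`). -/

namespace Recolour

open Finset Function Relation

set_option linter.unusedSectionVars false

variable {V C : Type*} [DecidableEq V] [DecidableEq C] {G : SimpleGraph V}

/-- `f` restricts to a proper colouring of `G[W]` with colours in `K`. -/
def Proper (G : SimpleGraph V) (W : Finset V) (K : Finset C) (f : V → C) : Prop :=
  (∀ v ∈ W, f v ∈ K) ∧ ∀ u ∈ W, ∀ v ∈ W, G.Adj u v → f u ≠ f v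

/-- `f` and `g` are proper on `G[W]` and arise from each other by recolouring one vertex of `W`. -/
def Step (G : SimpleGraph V) (W : Finset V) (K : Finset C) (f g : V → C) : Prop :=
  Proper G W K f ∧ Proper G W K g ∧ ∃ v ∈ W, ∃ c, g = update f v c

/-- `g` arises from `f` by a sequence of recolouring steps inside `W`. -/
def Reach (G : SimpleGraph V) (W : Finset V) (K : Finset C) : (V → C) → (V → C) → Prop :=
  ReflTransGen (Step G W K)

/-- Any two proper colourings of `G[W]` with colours in `K` are joined by recolouring steps. -/
def Mix (G : SimpleGraph V) (W : Finset V) (K : Finset C) : Prop :=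
  ∀ f g, Proper G W K f → Proper G W K g → (∀ v ∉ W, f v = g v) → Reach G W K f g

/-! ### Recolouring sequences. -/

theorem Step.symm {W : Finset V} {K : Finset C} {f g : V → C} (h : Step G W K f g) :
    Step G W K g f := by
  obtain ⟨hf, hg, v, hv, c, rfl⟩ := h
  exact ⟨hg, hf, v, hv, f v, by simp⟩

theorem Reach.symm {W : Finset V} {K : Finset C} {f g : V → C} (h : Reach G W K f g) :
    Reach G W K g f := by
  induction h with
  | refl => exact .refl
  | tail _ hs ih => exact .head hs.symm ih

theorem Reach.trans {W : Finset V} {K : Finset C} {f g h : V → C} (h₁ : Reach G W K f g)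
    (h₂ : Reach G W K g h) : Reach G W K f h :=
  ReflTransGen.trans h₁ h₂

theorem Reach.eq_off {W : Finset V} {K : Finset C} {f g : V → C} (h : Reach G W K f g) :
    ∀ v ∉ W, g v = f v := by
  induction h with
  | refl => simp
  | tail _ hs ih =>
    obtain ⟨_, _, v, hv, c, rfl⟩ := hs
    intro w hw
    rw [update_of_ne (by rintro rfl; exact hw hv), ih w hw]

theorem Reach.proper {W : Finset V} {K : Finset C} {f g : V → C} (h : Reach G W K f g)
    (hf : Proper G W K f) : Proper G W K g := by
  cases h with
  | refl => exact hf
  | tail _ hs => exact hs.2.1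

theorem Proper.mono {W W' : Finset V} {K : Finset C} {f : V → C} (hf : Proper G W K f)
    (hW : W' ⊆ W) : Proper G W' K f :=
  ⟨fun v hv => hf.1 v (hW hv), fun u hu v hv => hf.2 u (hW hu) v (hW hv)⟩

theorem Proper.congr {W : Finset V} {K : Finset C} {f g : V → C} (hf : Proper G W K f)
    (h : ∀ v ∈ W, g v = f v) : Proper G W K g :=
  ⟨fun v hv => h v hv ▸ hf.1 v hv, fun u hu v hv => by
    rw [h u hu, h v hv]; exact hf.2 u hu v hv⟩

theorem Proper.update {W : Finset V} {K : Finset C} {f : V → C} (hf : Proper G W K f) {v : V}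
    {c : C} (hc : c ∈ K) (h : ∀ w ∈ W, G.Adj v w → f w ≠ c) :
    Proper G W K (update f v c) := by
  refine ⟨fun w hw => ?_, fun u hu w hw huw => ?_⟩
  · by_cases hwv : w = v
    · simpa [hwv] using hc
    · simpa [hwv] using hf.1 w hw
  · have := hf.2 u hu w hw huw
    by_cases huv : u = v
    · subst huv
      simpa [huw.ne'] using (h w hw huw).symm
    · by_cases hwv : w = v
      · subst hwv
        simpa [huv] using h u hu huw.symm
      · simpa [huv, hwv]

/-- A recolouring of a part `W'` is a recolouring of `W` when its colours are not used on the
neighbours of `W'` in `W \ W'`. -/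
theorem Reach.lift {W W' : Finset V} {K K' : Finset C} {f g : V → C} (h : Reach G W' K' f g)
    (hf : Proper G W K f) (hW : W' ⊆ W) (hK : K' ⊆ K)
    (hd : ∀ u ∈ W', ∀ w ∈ W, w ∉ W' → G.Adj u w → f w ∉ K') : Reach G W K f g := by
  induction h with
  | refl => exact .refl
  | @tail b c hb hs ih =>
    have hbW := ih.proper hf
    have hoff := Reach.eq_off hb
    obtain ⟨_, hc, v, hv, q, rfl⟩ := hs
    have hqK : q ∈ K' := by simpa using hc.1 v hv
    refine ih.tail ⟨hbW, hbW.update (hK hqK) fun w hw hvw => ?_, v, hW hv, q, rfl⟩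
    by_cases hw' : w ∈ W'
    · have := hc.2 v hv w hw' hvw
      simpa [hvw.ne', eq_comm] using this
    · rw [hoff w hw']
      rintro rfl
      exact hd v hv w hw hw' hvw hqK

/-- An independent set can be recoloured with an unused colour. -/
theorem reach_piecewise {W T : Finset V} {K : Finset C} {f : V → C} {c : C}
    (hf : Proper G W K f) (hc : c ∈ K) (hmiss : ∀ v ∈ W, f v ≠ c) (hT : T ⊆ W)
    (hind : ∀ u ∈ T, ∀ v ∈ T, ¬ G.Adj u v) :
    Reach G W K f (T.piecewise (fun _ => c) f) := by
  induction T using Finset.induction_on with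
  | empty => rw [piecewise_empty]; exact .refl
  | insert a T ha ih =>
    have ih := ih (fun v hv => hT (mem_insert_of_mem hv)) fun u hu v hv =>
      hind u (mem_insert_of_mem hu) v (mem_insert_of_mem hv)
    have hp := ih.proper hf
    rw [Finset.piecewise_insert]
    refine ih.tail ⟨hp, hp.update hc fun w hw haw => ?_, a, hT (mem_insert_self _ _), c, rfl⟩
    by_cases hwT : w ∈ T
    · exact absurd haw (hind a (mem_insert_self _ _) w (mem_insert_of_mem hwT))
    · simpa [hwT] using hmiss w hw

/-! ### Mixing when the independence number is at most two. -/

/-- No three distinct vertices of `W` are pairwise nonadjacent. -/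
def NoIndepTriple (G : SimpleGraph V) (W : Finset V) : Prop :=
  ∀ x ∈ W, ∀ y ∈ W, ∀ z ∈ W, x ≠ y → y ≠ z → x ≠ z → G.Adj x y ∨ G.Adj y z ∨ G.Adj x z

/-- Classes have one or two vertices, and the weights make every class weigh 2: a singleton counts
2, a pair counts 1 + 1. -/
theorem sum_single_eq_two_mul_card_image {W : Finset V} {K : Finset C} {f : V → C}
    (hW : NoIndepTriple G W) (hf : Proper G W K f) :
    ∑ v ∈ W, (if ∀ w ∈ W, f w = f v → w = v then 2 else 1) = 2 * #(W.image f) := by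
  rw [← sum_fiberwise_of_maps_to (t := W.image f) (g := f) fun v hv => mem_image_of_mem f hv,
    mul_comm, ← smul_eq_mul, ← sum_const]
  refine sum_congr rfl fun c hc => ?_
  obtain ⟨x, hx, rfl⟩ := mem_image.1 hc
  by_cases h : ∀ w ∈ W, f w = f x → w = x
  · have : W.filter (fun v => f v = f x) = {x} := by
      ext v; simp only [mem_filter, mem_singleton]
      exact ⟨fun hv => h v hv.1 hv.2, by rintro rfl; exact ⟨hx, rfl⟩⟩
    rw [this, sum_singleton, if_pos h]
  · push Not at h
    obtain ⟨y, hy, hyx, hne⟩ := h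
    have : W.filter (fun v => f v = f x) = {x, y} := by
      ext v; simp only [mem_filter, mem_singleton, mem_insert]
      constructor
      · rintro ⟨hv, hvx⟩
        by_contra! hcon
        rcases hW x hx y hy v hv hne.symm hcon.2.symm hcon.1.symm with h | h | h
        · exact hf.2 _ hx _ hy h hyx.symm
        · exact hf.2 _ hy _ hv h (hyx.trans hvx.symm)
        · exact hf.2 _ hx _ hv h hvx.symm
      · rintro (rfl | rfl)
        exacts [⟨hx, rfl⟩, ⟨hy, hyx⟩]
    rw [this, sum_pair hne.symm, if_neg, if_neg]
    · exact fun h => hne (h x hx hyx.symm).symm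
    · exact fun h => hne (h y hy hyx)

/-- If `f` uses more colours than `g`, some vertex is alone in its `f`-class, not in its
`g`-class. -/
theorem exists_single_not_single {W : Finset V} {K : Finset C} {f g : V → C}
    (hW : NoIndepTriple G W) (hf : Proper G W K f) (hg : Proper G W K g)
    (hlt : #(W.image g) < #(W.image f)) :
    ∃ x ∈ W, ∃ y ∈ W, y ≠ x ∧ g y = g x ∧ ∀ w ∈ W, f w = f x → w = x := by
  by_contra! hcon
  have h₁ := sum_single_eq_two_mul_card_image hW hf
  have h₂ := sum_single_eq_two_mul_card_image hW hg
  -- If every `f`-singleton were a `g`-singleton, the weights for `f` would be at most those for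
  -- `g`, so `f` would use no more colours.
  have : ∑ v ∈ W, (if ∀ w ∈ W, f w = f v → w = v then 2 else 1) ≤
      ∑ v ∈ W, (if ∀ w ∈ W, g w = g v → w = v then 2 else 1) := by
    refine sum_le_sum fun v hv => ?_
    by_cases hs : ∀ w ∈ W, f w = f v → w = v
    · have : ∀ w ∈ W, g w = g v → w = v := by
        intro w hw hwv
        by_contra hne
        obtain ⟨u, hu, huv, hne'⟩ := hcon v hv w hw hne hwv
        exact hne' (hs u hu huv)
      rw [if_pos hs, if_pos this]
    · rw [if_neg hs]; split_ifs <;> simp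
  omega

/-- Some colour class of `g` can be made a colour class of `f` by recolouring. -/
theorem exists_reach_common_class {W : Finset V} {K : Finset C} {f g : V → C}
    (hW : NoIndepTriple G W) (hne : W.Nonempty) (hf : Proper G W K f) (hg : Proper G W K g)
    (hmiss : ∃ c ∈ K, ∀ v ∈ W, g v ≠ c) :
    ∃ f' : V → C, ∃ d ∈ K, ∃ x ∈ W, Reach G W K f f' ∧ ∀ v ∈ W, f' v = d ↔ g v = g x := by
  by_cases hs : ∃ c ∈ K, ∀ v ∈ W, f v ≠ c
  · obtain ⟨c, hc, hfc⟩ := hs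
    obtain ⟨x, hx⟩ := hne
    refine ⟨_, c, hc, x, hx, reach_piecewise (T := W.filter fun v => g v = g x) hf hc hfc
      (filter_subset _ _) ?_, ?_⟩
    · intro u hu v hv huv
      rw [mem_filter] at hu hv
      exact hg.2 u hu.1 v hv.1 huv (hu.2.trans hv.2.symm)
    · intro v hv
      by_cases h : g v = g x
      · simp [hv, h]
      · simp [h, hfc v hv]
  -- Here `f` uses all of `K` and `g` does not, so some `f`-singleton `x` is paired with `y` by `g`;
  -- giving `y` the colour of `x` creates this pair.
  · push Not at hs
    obtain ⟨c, hc, hgc⟩ := hmiss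
    have hlt : #(W.image g) < #(W.image f) := by
      refine card_lt_card ⟨?_, fun h => ?_⟩
      · intro a ha
        obtain ⟨v, hv, rfl⟩ := mem_image.1 ha
        obtain ⟨w, hw, h⟩ := hs _ (hg.1 v hv)
        exact mem_image.2 ⟨w, hw, h⟩
      · obtain ⟨w, hw, h'⟩ := hs c hc
        obtain ⟨v, hv, h''⟩ := mem_image.1 (h (mem_image.2 ⟨w, hw, h'⟩))
        exact hgc v hv h''
    obtain ⟨x, hx, y, hy, hyx, hgyx, hsx⟩ := exists_single_not_single hW hf hg hlt
    have hnadj : ¬ G.Adj y x := fun h => hg.2 y hy x hx h hgyx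
    refine ⟨update f y (f x), f x, hf.1 x hx, x, hx, ReflTransGen.single ⟨hf,
      hf.update (hf.1 x hx) fun w hw hyw h => ?_, y, hy, _, rfl⟩, ?_⟩
    · rw [hsx w hw h] at hyw
      exact hnadj hyw
    · intro v hv
      by_cases hvy : v = y
      · subst hvy; simp [hgyx]
      · rw [update_of_ne hvy]
        constructor
        · intro h; rw [hsx v hv h]
        · intro h
          by_contra hvx
          have hvx' : v ≠ x := fun h => hvx (by rw [h])
          rcases hW x hx y hy v hv hyx.symm (Ne.symm hvy) hvx'.symm with h' | h' | h'
          · exact hnadj h'.symm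
          · exact hg.2 _ hy _ hv h' (hgyx.trans h.symm)
          · exact hg.2 _ hx _ hv h' h.symm

/-- A colouring with an unused colour can be recoloured so that the class of `x` gets colour `d`,
the classes are the same, and some colour is unused. -/
theorem exists_reach_rename {W : Finset V} {K : Finset C} {g : V → C} {x : V} {d : C}
    (hg : Proper G W K g) (hmiss : ∃ c ∈ K, ∀ v ∈ W, g v ≠ c) (hd : d ∈ K) (hx : x ∈ W) :
    ∃ g' : V → C, Reach G W K g g' ∧ (∀ v ∈ W, g' v = d ↔ g v = g x) ∧
      ∃ c ∈ K, ∀ v ∈ W, g' v ≠ c := by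
  by_cases hdx : g x = d
  · exact ⟨g, .refl, fun v _ => by rw [hdx], hmiss⟩
  obtain ⟨c, hc, hgc⟩ := hmiss
  have hind : ∀ a, ∀ u ∈ W.filter (fun v => g v = a), ∀ v ∈ W.filter (fun v => g v = a),
      ¬ G.Adj u v := by
    intro a u hu v hv huv
    rw [mem_filter] at hu hv
    exact hg.2 u hu.1 v hv.1 huv (hu.2.trans hv.2.symm)
  -- The unused colour `c` serves as a buffer: class `d` moves to `c`, the class of `x` moves to
  -- `d`, and the colour `g x` becomes unused.
  have h₁ := reach_piecewise (T := W.filter fun v => g v = d) hg hc hgc (filter_subset _ _)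
    (hind d)
  set g₁ := (W.filter fun v => g v = d).piecewise (fun _ => c) g with hg₁
  have hval : ∀ v ∈ W, g₁ v = if g v = d then c else g v := by
    intro v hv
    by_cases h : g v = d <;> simp [hg₁, hv, h]
  have hmiss₁ : ∀ v ∈ W, g₁ v ≠ d := by
    intro v hv
    rw [hval v hv]
    split_ifs with h
    · rintro rfl; exact hgc v hv h
    · exact h
  have h₂ := reach_piecewise (T := W.filter fun v => g v = g x) (h₁.proper hg) hd hmiss₁
    (filter_subset _ _) (hind _)
  refine ⟨_, h₁.trans h₂, ?_, g x, hg.1 x hx, ?_⟩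
  · intro v hv
    by_cases h : g v = g x
    · simp [hv, h]
    · simpa [h] using hmiss₁ v hv
  · intro v hv
    by_cases h : g v = g x
    · simpa [hv, h] using Ne.symm hdx
    · simp only [mem_filter, h, and_false, not_false_eq_true, piecewise_eq_of_notMem]
      rw [hval v hv]
      split_ifs
      · exact (hgc x hx).symm
      · exact h

/-- Once both colourings share a class of colour `d`, that class is frozen and the rest is
recoloured without `d`; the target still misses a colour there, so induction applies. -/
theorem reach_of_noIndepTriple (W : Finset V) (hW : NoIndepTriple G W) (K : Finset C)
    (f g : V → C) (hf : Proper G W K f) (hg : Proper G W K g) (hoff : ∀ v ∉ W, f v = g v)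
    (hmiss : ∃ c ∈ K, ∀ v ∈ W, g v ≠ c) : Reach G W K f g := by
  induction W using Finset.strongInduction generalizing K f g with
  | H W ih =>
  rcases W.eq_empty_or_nonempty with rfl | hne
  · have : f = g := funext fun v => hoff v (by simp)
    exact this ▸ .refl
  obtain ⟨f', d, hd, x, hx, hff', hf'⟩ := exists_reach_common_class hW hne hf hg hmiss
  obtain ⟨g', hgg', hg', c, hc, hmiss'⟩ := exists_reach_rename hg hmiss hd hx
  refine hff'.trans (Reach.trans ?_ hgg'.symm)
  have hdc : d ≠ c := by
    rintro rfl
    exact hmiss' x hx ((hg' x hx).2 rfl)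
  set W' := W.filter fun v => g v ≠ g x with hW'
  have hsub : W' ⊆ W := filter_subset _ _
  have hclass : ∀ {h : V → C}, Proper G W K h → (∀ v ∈ W, h v = d ↔ g v = g x) →
      Proper G W' (K.erase d) h := fun {h} hp hh =>
    ⟨fun v hv => mem_erase.2 ⟨fun hvd => (mem_filter.1 hv).2 ((hh v (hsub hv)).1 hvd),
      hp.1 v (hsub hv)⟩, (hp.mono hsub).2⟩
  have hpf := hff'.proper hf
  have hpg := hgg'.proper hg
  refine (ih W' (filter_ssubset.2 ⟨x, hx, by simp⟩) (fun x hx y hy z hz =>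
    hW x (hsub hx) y (hsub hy) z (hsub hz)) (K.erase d) f' g' (hclass hpf hf')
    (hclass hpg hg') ?_ ⟨c, mem_erase.2 ⟨hdc.symm, hc⟩, fun v hv => hmiss' v (hsub hv)⟩).lift
    hpf hsub (erase_subset _ _) ?_
  · intro v hv
    by_cases hvW : v ∈ W
    · have : g v = g x := by simpa [hW', hvW] using hv
      rw [(hf' v hvW).2 this, (hg' v hvW).2 this]
    · rw [hff'.eq_off v hvW, hgg'.eq_off v hvW, hoff v hvW]
  · intro u _ w hw hw' _
    have : g w = g x := by simpa [hW', hw] using hw'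
    simp [(hf' w hw).2 this]

/-- `G[W]` has a colouring with fewer than `k` colours out of `C`. -/
def ColourableLT (C : Type*) [DecidableEq C] (G : SimpleGraph V) (W : Finset V) (k : ℕ) : Prop :=
  ∃ f : V → C, (∀ u ∈ W, ∀ v ∈ W, G.Adj u v → f u ≠ f v) ∧ #(W.image f) < k

/-- A colouring with fewer than `#K` colours can be taken to avoid a given colour of `K`. -/
theorem ColourableLT.exists_proper {W : Finset V} {K : Finset C}
    (h : ColourableLT C G W #K) {q : C} (hq : q ∈ K) :
    ∃ f : V → C, Proper G W (K.erase q) f := by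
  obtain ⟨f, hf, hlt⟩ := h
  have hle : #(W.image f) ≤ #(K.erase q) := by rw [card_erase_of_mem hq]; omega
  obtain ⟨e⟩ : Nonempty ((W.image f : Finset C) ↪ (K.erase q : Finset C)) :=
    Function.Embedding.nonempty_of_card_le (by simpa using hle)
  refine ⟨fun v => if hv : v ∈ W then e ⟨f v, mem_image_of_mem f hv⟩ else q, ?_, ?_⟩
  · intro v hv
    simp only [hv, dif_pos]
    exact (e _).2
  · intro u hu v hv huv
    simp only [hu, hv, dif_pos]
    intro h
    have := e.injective (Subtype.ext h)
    exact hf u hu v hv huv (by simpa using this)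

/-- Both colourings are led to one intermediate colouring that misses a colour `q`. -/
theorem mix_of_noIndepTriple {W : Finset V} {K : Finset C} (hW : NoIndepTriple G W)
    (hcol : ColourableLT C G W #K) : Mix G W K := by
  intro f g hf hg hoff
  obtain ⟨q, hq⟩ : K.Nonempty := by
    obtain ⟨_, _, h⟩ := hcol
    exact card_pos.1 (by omega)
  obtain ⟨h, hh⟩ := hcol.exists_proper hq
  have hp : Proper G W (K.erase q) (W.piecewise h f) :=
    hh.congr fun v hv => by simp [hv]
  have hp' : Proper G W K (W.piecewise h f) :=
    ⟨fun v hv => mem_of_mem_erase (hp.1 v hv), hp.2⟩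
  have hmiss : ∃ c ∈ K, ∀ v ∈ W, W.piecewise h f v ≠ c :=
    ⟨q, hq, fun v hv => ne_of_mem_erase (hp.1 v hv)⟩
  refine (reach_of_noIndepTriple W hW K f _ hf hp' (fun v hv => by simp [hv]) hmiss).trans
    (reach_of_noIndepTriple W hW K g _ hg hp' (fun v hv => by simp [hv, hoff v hv]) hmiss).symm

/-! ### Modules with clique neighbourhood. -/

/-- `M` is a homogeneous set of `G[W]` whose neighbourhood in `W \ M` is the clique `B`. -/
structure IsCliqueModule (G : SimpleGraph V) (W M B : Finset V) : Prop where
  subset : M ⊆ W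
  subset_sdiff : B ⊆ W \ M
  clique : ∀ u ∈ B, ∀ v ∈ B, u ≠ v → G.Adj u v
  complete : ∀ u ∈ B, ∀ v ∈ M, G.Adj u v
  mem_of_adj : ∀ u ∈ M, ∀ v ∈ W, v ∉ M → G.Adj u v → v ∈ B

namespace IsCliqueModule

variable {W M B : Finset V} {K : Finset C} {f : V → C}

theorem mem_left (hM : IsCliqueModule G W M B) {v : V} (hv : v ∈ B) : v ∈ W :=
  (mem_sdiff.1 (hM.subset_sdiff hv)).1

theorem card_image (hM : IsCliqueModule G W M B)
    (hf : ∀ u ∈ W, ∀ v ∈ W, G.Adj u v → f u ≠ f v) : #(B.image f) = #B := by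
  refine card_image_of_injOn fun u hu v hv h => ?_
  by_contra hne
  exact hf u (hM.mem_left hu) v (hM.mem_left hv) (hM.clique u hu v hv hne) h

theorem card_sdiff_image (hM : IsCliqueModule G W M B) (hf : Proper G W K f) :
    #(K \ B.image f) + #B = #K := by
  rw [← hM.card_image hf.2]
  refine card_sdiff_add_card_eq_card fun c hc => ?_
  obtain ⟨v, hv, rfl⟩ := mem_image.1 hc
  exact hf.1 v (hM.mem_left hv)

theorem proper_sdiff_image (hM : IsCliqueModule G W M B) (hf : Proper G W K f) :
    Proper G M (K \ B.image f) f := by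
  refine ⟨fun v hv => mem_sdiff.2 ⟨hf.1 v (hM.subset hv), fun h => ?_⟩, (hf.mono hM.subset).2⟩
  obtain ⟨b, hb, h⟩ := mem_image.1 h
  exact hf.2 b (hM.mem_left hb) v (hM.subset hv) (hM.complete b hb v hv) h

/-- The clique `B` takes `#B` distinct colours, none of which occurs on `M`. -/
theorem colourableLT (hM : IsCliqueModule G W M B) {k l : ℕ} (hcol : ColourableLT C G W l)
    (hk : k + #B = l) : ColourableLT C G M k := by
  obtain ⟨f, hf, hlt⟩ := hcol
  refine ⟨f, fun u hu v hv => hf u (hM.subset hu) v (hM.subset hv), ?_⟩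
  have hdisj : Disjoint (M.image f) (B.image f) := by
    rw [disjoint_left]
    intro c hc hc'
    obtain ⟨v, hv, rfl⟩ := mem_image.1 hc
    obtain ⟨b, hb, h⟩ := mem_image.1 hc'
    exact hf b (hM.mem_left hb) v (hM.subset hv) (hM.complete b hb v hv) h
  have hle : #(M.image f) + #(B.image f) ≤ #(W.image f) := by
    rw [← card_union_of_disjoint hdisj, ← image_union]
    exact card_le_card (image_subset_image
      (union_subset hM.subset fun v hv => hM.mem_left hv))
  rw [hM.card_image hf] at hle
  omega

/-- With `B` fixed, mixing inside `M` over the colours absent from `B` never conflicts with the rest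
of `W`. -/
theorem reach_of_reach (hM : IsCliqueModule G W M B)
    (hmix : ∀ K' ⊆ K, #K' + #B = #K → Mix G M K') {g : V → C} (hf : Proper G W K f)
    (hg : Proper G W K g) (hoff : ∀ v ∉ M, f v = g v) : Reach G W K f g := by
  have himg : B.image f = B.image g := image_congr fun v hv =>
    hoff v (mem_sdiff.1 (hM.subset_sdiff hv)).2
  refine (hmix (K \ B.image f) sdiff_subset (hM.card_sdiff_image hf) f g
    (hM.proper_sdiff_image hf) (himg ▸ hM.proper_sdiff_image hg) hoff).lift hf hM.subset
    sdiff_subset fun u hu w hw hw' huw h => ?_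
  exact (mem_sdiff.1 h).2 (mem_image_of_mem f (hM.mem_of_adj u hu w hw hw' huw))

/-- A sequence on `W \ M` is followed in `W`, with `M` recoloured out of the way whenever a vertex
of `B` is about to change. -/
theorem exists_reach (hM : IsCliqueModule G W M B)
    (hmix : ∀ K' ⊆ K, #K' + #B = #K → Mix G M K') (hcol : ColourableLT C G W #K)
    (hf : Proper G W K f) {g : V → C} (h : Reach G (W \ M) K f g) :
    ∃ g' : V → C, Reach G W K f g' ∧ ∀ v ∉ M, g' v = g v := by
  induction h with
  | refl => exact ⟨f, .refl, fun _ _ => rfl⟩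
  | @tail b c hb hs ih =>
  obtain ⟨b', hfb', hb'⟩ := ih
  obtain ⟨_, hc, v, hv, q, rfl⟩ := hs
  have hpb := hfb'.proper hf
  obtain ⟨hvW, hvM⟩ := mem_sdiff.1 hv
  have hqK : q ∈ K := by simpa using hc.1 v hv
  have hout : ∀ w ∈ W, w ∉ M → G.Adj v w → b' w ≠ q := by
    intro w hw hwM hvw
    have := hc.2 v hv w (mem_sdiff.2 ⟨hw, hwM⟩) hvw
    rw [hb' w hwM]
    simpa [hvw.ne', eq_comm] using this
  have hend : ∀ h : V → C, (∀ w ∉ M, h w = b' w) →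
      ∀ w ∉ M, update h v q w = update b v q w := by
    intro h hh w hw
    by_cases hwv : w = v
    · simp [hwv]
    · simp [hwv, hh w hw, hb' w hw]
  by_cases hvB : v ∈ B
  · by_cases hqv : b' v = q
    · refine ⟨b', hfb', fun w hw => ?_⟩
      rw [← hend b' (fun _ _ => rfl) w hw, ← hqv, update_eq_self]
    have hq : q ∈ K \ B.image b' := by
      refine mem_sdiff.2 ⟨hqK, fun h => ?_⟩
      obtain ⟨w, hw, h⟩ := mem_image.1 h
      have hne : v ≠ w := by rintro rfl; exact hqv h
      obtain ⟨hwW, hwM⟩ := mem_sdiff.1 (hM.subset_sdiff hw)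
      exact hout w hwW hwM (hM.clique v hvB w hw hne) h
    -- The colours absent from `B` outnumber those needed on `M`, so `M` can do without `q`.
    obtain ⟨h, hh⟩ := (hM.colourableLT hcol (hM.card_sdiff_image hpb)).exists_proper hq
    set h' := M.piecewise h b' with hh'
    have hoff : ∀ w ∉ M, h' w = b' w := fun w hw => by simp [hh', hw]
    have hon : ∀ w ∈ M, h' w = h w := fun w hw => by simp [hh', hw]
    have hsub : ∀ w ∈ M, h' w ≠ q ∧ h' w ∈ K ∧ h' w ∉ B.image b' := by
      intro w hw
      simpa [hon w hw] using hh.1 w hw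
    have hcross : ∀ u ∈ M, ∀ w ∈ W, w ∉ M → G.Adj u w → h' u ≠ h' w := by
      intro u hu w hw hwM huw heq
      rw [hoff w hwM] at heq
      exact (hsub u hu).2.2 (heq ▸ mem_image_of_mem b' (hM.mem_of_adj u hu w hw hwM huw))
    have hph : Proper G W K h' := by
      refine ⟨fun w hw => ?_, fun u hu w hw huw => ?_⟩
      · by_cases hwM : w ∈ M
        · exact (hsub w hwM).2.1
        · rw [hoff w hwM]; exact hpb.1 w hw
      · by_cases huM : u ∈ M <;> by_cases hwM : w ∈ M
        · rw [hon u huM, hon w hwM]; exact hh.2 u huM w hwM huw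
        · exact hcross u huM w hw hwM huw
        · exact (hcross w hwM u hu huM huw.symm).symm
        · rw [hoff u huM, hoff w hwM]; exact hpb.2 u hu w hw huw
    refine ⟨update h' v q, (hfb'.trans (hM.reach_of_reach hmix hpb hph
      fun w hw => (hoff w hw).symm)).tail
      ⟨hph, hph.update hqK fun w hw hvw => ?_, v, hvW, q, rfl⟩, hend h' hoff⟩
    by_cases hwM : w ∈ M
    · exact (hsub w hwM).1
    · rw [hoff w hwM]; exact hout w hw hwM hvw
  · refine ⟨update b' v q, hfb'.tail ⟨hpb, hpb.update hqK fun w hw hvw => ?_, v, hvW, q, rfl⟩,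
      hend b' fun _ _ => rfl⟩
    refine hout w hw (fun hwM => hvB ?_) hvw
    exact hM.mem_of_adj w hwM v hvW hvM hvw.symm

theorem mix (hM : IsCliqueModule G W M B) (hmix : ∀ K' ⊆ K, #K' + #B = #K → Mix G M K')
    (hmix' : Mix G (W \ M) K) (hcol : ColourableLT C G W #K) : Mix G W K := by
  intro f g hf hg hoff
  -- `Mix` on `W \ M` needs colourings that agree off `W \ M`, hence the values of `f` on `M`.
  set g₀ := M.piecewise f g with hg₀
  have hg₀' : Proper G (W \ M) K g₀ := (hg.mono sdiff_subset).congr fun v hv => by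
    simp [hg₀, (mem_sdiff.1 hv).2]
  obtain ⟨g', hfg', hg'⟩ := hM.exists_reach hmix hcol hf
    (hmix' f g₀ (hf.mono sdiff_subset) hg₀' fun v hv => by
      by_cases hvM : v ∈ M
      · simp [hg₀, hvM]
      · have : v ∉ W := by simpa [hvM] using hv
        simp [hg₀, hvM, hoff v this])
  refine hfg'.trans (hM.reach_of_reach hmix (hfg'.proper hf) hg fun v hv => ?_)
  rw [hg' v hv]
  simp [hg₀, hv]

end IsCliqueModule

/-! ### Graphs containing an induced five-cycle. -/

/-- `G` has no induced path on five vertices; distinctness of the vertices is automatic. -/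
def P5Free (G : SimpleGraph V) : Prop :=
  ∀ a b c d e, G.Adj a b → G.Adj b c → G.Adj c d → G.Adj d e → ¬ G.Adj a c → ¬ G.Adj a d →
    ¬ G.Adj a e → ¬ G.Adj b d → ¬ G.Adj b e → ¬ G.Adj c e → False

/-- `G` has no induced cycle on four vertices. -/
def C4Free (G : SimpleGraph V) : Prop :=
  ∀ a b c d, G.Adj a b → G.Adj b c → G.Adj c d → G.Adj d a → a ≠ c → b ≠ d →
    ¬ G.Adj a c → ¬ G.Adj b d → False

/-- `c` is an induced five-cycle of `G`. -/
def IsC5 (G : SimpleGraph V) (c : ZMod 5 → V) : Prop :=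
  ∀ i, G.Adj (c i) (c (i + 1)) ∧ ¬ G.Adj (c i) (c (i + 2))

/-- On the five-cycle `c`, the vertex `v` has the neighbours of `c i`, and perhaps `c i`. -/
def IsTwin (G : SimpleGraph V) (c : ZMod 5 → V) (v : V) (i : ZMod 5) : Prop :=
  G.Adj v (c (i + 1)) ∧ ¬ G.Adj v (c (i + 2)) ∧ ¬ G.Adj v (c (i + 3)) ∧ G.Adj v (c (i + 4))

section FiveCycle

variable {c : ZMod 5 → V} {i j : ZMod 5} {u v : V}

theorem IsC5.adj (hc : IsC5 G c) (h : j = i + 1) : G.Adj (c i) (c j) := h ▸ (hc i).1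

theorem IsC5.not_adj (hc : IsC5 G c) (h : j = i + 2) : ¬ G.Adj (c i) (c j) := h ▸ (hc i).2

theorem IsC5.isTwin (hc : IsC5 G c) (i : ZMod 5) : IsTwin G c (c i) i := by
  have h₃ : i = i + 3 + 2 := by clear * - i; revert i; decide
  have h₄ : i = i + 4 + 1 := by clear * - i; revert i; decide
  exact ⟨hc.adj rfl, hc.not_adj rfl, fun h => hc.not_adj h₃ h.symm, (hc.adj h₄).symm⟩

theorem IsC5.complete_or_isTwin (hP : P5Free G) (hC : C4Free G) (hc : IsC5 G c)
    (hv : G.Adj v (c j)) : (∀ i, G.Adj v (c i)) ∨ ∃ i, IsTwin G c v i := by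
  by_cases hrange : ∃ i, v = c i
  · obtain ⟨i, rfl⟩ := hrange
    exact .inr ⟨i, hc.isTwin i⟩
  push Not at hrange
  by_cases hstep : ∀ i, G.Adj v (c i) → G.Adj v (c (i + 1))
  · left
    have h₁ := hstep _ hv
    have h₂ := hstep _ h₁
    have h₃ := hstep _ h₂
    have h₄ := hstep _ h₃
    intro i
    have : i = j ∨ i = j + 1 ∨ i = j + 1 + 1 ∨ i = j + 1 + 1 + 1 ∨ i = j + 1 + 1 + 1 + 1 := by
      clear * - i j; revert i j; decide
    rcases this with rfl | rfl | rfl | rfl | rfl <;> assumption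
  push Not at hstep
  -- When `v` sees `c i` but not `c (i + 1)`, C₄-freeness excludes `c (i + 2)` and P₅-freeness
  -- forces `c (i + 3)`, so `v` is a twin of `c (i + 4)`.
  obtain ⟨i, h₀, h₁⟩ := hstep
  have e₁ : i + 2 = i + 1 + 1 := by clear * - i; revert i; decide
  have e₂ : i + 3 = i + 2 + 1 := by clear * - i; revert i; decide
  have e₃ : i + 4 = i + 3 + 1 := by clear * - i; revert i; decide
  have e₄ : i = i + 4 + 1 := by clear * - i; revert i; decide
  have e₅ : i + 3 = i + 1 + 2 := by clear * - i; revert i; decide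
  have e₆ : i = i + 3 + 2 := by clear * - i; revert i; decide
  have n₀₂ : ¬ G.Adj (c i) (c (i + 2)) := hc.not_adj rfl
  have n₀₃ : ¬ G.Adj (c i) (c (i + 3)) := fun h => hc.not_adj e₆ h.symm
  have n₁₃ : ¬ G.Adj (c (i + 1)) (c (i + 3)) := hc.not_adj e₅
  have ne₀₂ : c i ≠ c (i + 2) := fun h => n₀₃ (h ▸ hc.adj e₂)
  have ne₀₃ : c i ≠ c (i + 3) := fun h => n₀₂ (h ▸ (hc.adj e₂).symm)
  have h₂ : ¬ G.Adj v (c (i + 2)) := fun h₂ =>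
    hC v (c i) (c (i + 1)) (c (i + 2)) h₀ (hc.adj rfl) (hc.adj e₁) h₂.symm (hrange _) ne₀₂ h₁ n₀₂
  have h₃ : G.Adj v (c (i + 3)) := by
    by_contra h₃
    exact hP v (c i) (c (i + 1)) (c (i + 2)) (c (i + 3)) h₀ (hc.adj rfl) (hc.adj e₁) (hc.adj e₂)
      h₁ h₂ h₃ n₀₂ n₀₃ n₁₃
  refine .inr ⟨i + 4, ?_⟩
  have a₁ : i + 4 + 2 = i + 1 := by clear * - i; revert i; decide
  have a₂ : i + 4 + 3 = i + 2 := by clear * - i; revert i; decide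
  have a₃ : i + 4 + 4 = i + 3 := by clear * - i; revert i; decide
  rw [IsTwin, ← e₄, a₁, a₂, a₃]
  exact ⟨h₀, h₁, h₂, h₃⟩

theorem IsC5.facts (hc : IsC5 G c) (i : ZMod 5) :
    G.Adj (c (i + 1)) (c (i + 2)) ∧ G.Adj (c (i + 2)) (c (i + 3)) ∧
    G.Adj (c (i + 3)) (c (i + 4)) ∧ ¬ G.Adj (c (i + 1)) (c (i + 3)) ∧
    ¬ G.Adj (c (i + 1)) (c (i + 4)) ∧ ¬ G.Adj (c (i + 2)) (c (i + 4)) ∧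
    c (i + 1) ≠ c (i + 4) := by
  have n : ¬ G.Adj (c (i + 2)) (c (i + 4)) := hc.not_adj (by clear * - i; revert i; decide)
  have a : G.Adj (c (i + 1)) (c (i + 2)) := hc.adj (by clear * - i; revert i; decide)
  refine ⟨a, hc.adj (by clear * - i; revert i; decide), hc.adj (by clear * - i; revert i; decide),
    hc.not_adj (by clear * - i; revert i; decide), fun h => ?_, n, fun h => n (h ▸ a.symm)⟩
  exact hc.not_adj (i := i + 4) (j := i + 1) (by clear * - i; revert i; decide) h.symm

/-- Otherwise `u, c (i + 1), v, c (i + 4)` is an induced C₄. -/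
theorem IsTwin.adj (hC : C4Free G) (hc : IsC5 G c) (hu : IsTwin G c u i) (hv : IsTwin G c v i)
    (hne : u ≠ v) : G.Adj u v := by
  by_contra h
  obtain ⟨-, -, -, -, n, -, ne⟩ := hc.facts i
  exact hC u _ v _ hu.1 hv.1.symm hv.2.2.2 hu.2.2.2.symm hne ne h n

/-- Otherwise `u, c (i + 4), c (i + 3), c (i + 2), v` is an induced P₅. -/
theorem IsTwin.adj_succ (hP : P5Free G) (hc : IsC5 G c) (hu : IsTwin G c u i)
    (hv : IsTwin G c v (i + 1)) : G.Adj u v := by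
  by_contra h
  obtain ⟨-, a₂, a₃, -, -, n, -⟩ := hc.facts i
  have e₁ : i + 1 + 1 = i + 2 := by clear * - i; revert i; decide
  have e₂ : i + 1 + 2 = i + 3 := by clear * - i; revert i; decide
  have e₃ : i + 1 + 3 = i + 4 := by clear * - i; revert i; decide
  rw [IsTwin, e₁, e₂, e₃] at hv
  exact hP u _ _ _ v hu.2.2.2 a₃.symm a₂.symm hv.1.symm hu.2.2.1 hu.2.1 h
    (fun h => n h.symm) (fun h => hv.2.2.1 h.symm) (fun h => hv.2.1 h.symm)

/-- `M` is the set of twins and `B` the set of vertices complete to the cycle. -/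
theorem IsC5.exists_isCliqueModule (hP : P5Free G) (hC : C4Free G) (hc : IsC5 G c)
    {W : Finset V} (hW : ∀ i, c i ∈ W) :
    ∃ M B : Finset V, M.Nonempty ∧ NoIndepTriple G M ∧ IsCliqueModule G W M B := by
  classical
  refine ⟨W.filter fun v => ∃ i, IsTwin G c v i, W.filter fun v => ∀ i, G.Adj v (c i),
    ⟨c 0, mem_filter.2 ⟨hW 0, 0, hc.isTwin 0⟩⟩, ?_, ?_⟩
  · intro x hx y hy z hz hxy hyz hxz
    obtain ⟨-, i, hi⟩ := mem_filter.1 hx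
    obtain ⟨-, j, hj⟩ := mem_filter.1 hy
    obtain ⟨-, k, hk⟩ := mem_filter.1 hz
    have key : ∀ {x y : V} {i j : ZMod 5}, IsTwin G c x i → IsTwin G c y j → x ≠ y →
        (j = i ∨ j = i + 1 ∨ i = j + 1) → G.Adj x y := by
      rintro x y i j hi hj hxy (rfl | rfl | rfl)
      · exact hi.adj hC hc hj hxy
      · exact hi.adj_succ hP hc hj
      · exact (hj.adj_succ hP hc hi).symm
    -- Among any three residues mod 5, two are equal or consecutive.
    have : (j = i ∨ j = i + 1 ∨ i = j + 1) ∨ (k = j ∨ k = j + 1 ∨ j = k + 1) ∨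
        (k = i ∨ k = i + 1 ∨ i = k + 1) := by
      clear * - i j k; revert i j k; decide
    exact this.imp (key hi hj hxy) (Or.imp (key hj hk hyz) (key hi hk hxz))
  · refine ⟨filter_subset _ _, ?_, ?_, ?_, ?_⟩
    · intro v hv
      obtain ⟨hvW, hv⟩ := mem_filter.1 hv
      refine mem_sdiff.2 ⟨hvW, fun h => ?_⟩
      obtain ⟨-, i, hi⟩ := mem_filter.1 h
      exact hi.2.1 (hv _)
    · intro u hu v hv hne
      obtain ⟨-, hu⟩ := mem_filter.1 hu
      obtain ⟨-, hv⟩ := mem_filter.1 hv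
      by_contra h
      obtain ⟨-, -, -, -, n, -, ne⟩ := hc.facts 0
      exact hC u _ v _ (hu _) (hv _).symm (hv _) (hu _).symm hne ne h n
    · intro u hu v hv
      obtain ⟨-, hu⟩ := mem_filter.1 hu
      obtain ⟨-, i, hi⟩ := mem_filter.1 hv
      by_contra h
      obtain ⟨-, -, -, -, n, -, ne⟩ := hc.facts i
      refine hC u _ v _ (hu _) hi.1.symm hi.2.2.2 (hu _).symm ?_ ne h n
      rintro rfl
      exact hi.2.1 (hu _)
    · intro u hu v hvW hv huv
      obtain ⟨-, i, hi⟩ := mem_filter.1 hu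
      have hnt : ¬ ∃ i, IsTwin G c v i := fun h => hv (mem_filter.2 ⟨hvW, h⟩)
      refine mem_filter.2 ⟨hvW, ?_⟩
      by_cases hadj : ∃ j, G.Adj v (c j)
      · obtain ⟨j, hj⟩ := hadj
        exact (hc.complete_or_isTwin hP hC hj).resolve_right hnt
      · push Not at hadj
        obtain ⟨a₁, a₂, -, n, -, -, -⟩ := hc.facts i
        -- A vertex `v` with no neighbour on the cycle would start the induced path `v, u, c (i +
        -- 1), c (i + 2), c (i + 3)`.
        exact (hP v u _ _ _ huv.symm hi.1 a₁ a₂ (hadj _) (hadj _) (hadj _) hi.2.1 hi.2.2.1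
          n).elim

end FiveCycle

/-! ### Graphs without an induced five-cycle. -/

/-- Any two nonadjacent outside neighbours of `X` are joined through `X` by a path with at most two
inner vertices. -/
def ShortLinked (G : SimpleGraph V) (W X : Finset V) : Prop :=
  ∀ y ∈ W, ∀ z ∈ W, y ∉ X → z ∉ X → y ≠ z → ¬ G.Adj y z → (∃ x ∈ X, G.Adj y x) →
    (∃ x ∈ X, G.Adj z x) → ∃ x ∈ X, ∃ x' ∈ X, G.Adj y x ∧ G.Adj z x' ∧ (x = x' ∨ G.Adj x x')

theorem ShortLinked.insert_vertex (hP : P5Free G) {W X : Finset V} (hX : ShortLinked G W X) {y : V}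
    (hyW : y ∈ W) (hyX : y ∉ X) (hy : ∃ x ∈ X, G.Adj y x) : ShortLinked G W (insert y X) := by
  -- The essential case: `z₁` sees `X`, while `z₂` sees only the new vertex `y`. Linking `z₁` to `y`
  -- through `X` gives a short link to `z₂` or an induced P₅.
  have key : ∀ z₁ ∈ W, ∀ z₂ ∈ W, z₁ ∉ insert y X → ¬ G.Adj z₁ z₂ → (∃ x ∈ X, G.Adj z₁ x) →
      (¬ ∃ x ∈ X, G.Adj z₂ x) → G.Adj z₂ y → ∃ x ∈ insert y X, ∃ x' ∈ insert y X,
        G.Adj z₁ x ∧ G.Adj z₂ x' ∧ (x = x' ∨ G.Adj x x') := by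
    intro z₁ h₁ z₂ h₂ hz₁ hn hX₁ hX₂ hzy
    obtain ⟨hz₁y, hz₁X⟩ := not_or.1 (mt mem_insert.2 hz₁)
    push Not at hX₂
    by_cases hadj : G.Adj z₁ y
    · exact ⟨y, mem_insert_self _ _, y, mem_insert_self _ _, hadj, hzy, .inl rfl⟩
    obtain ⟨x, hx, x', hx', hzx, hyx', h⟩ := hX z₁ h₁ y hyW hz₁X hyX hz₁y hadj hX₁ hy
    by_cases hxy : G.Adj x y
    · exact ⟨x, mem_insert_of_mem hx, y, mem_insert_self _ _, hzx, hzy, .inr hxy⟩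
    rcases h with rfl | h
    · exact absurd hyx'.symm hxy
    by_cases hzx' : G.Adj z₁ x'
    · exact ⟨x', mem_insert_of_mem hx', y, mem_insert_self _ _, hzx', hzy, .inr hyx'.symm⟩
    exact (hP z₁ x x' y z₂ hzx h hyx'.symm hzy.symm hzx' hadj hn hxy
      (fun h => hX₂ x hx h.symm) (fun h => hX₂ x' hx' h.symm)).elim
  intro z₁ h₁ z₂ h₂ hz₁ hz₂ hne hn ⟨x₁, hx₁, hzx₁⟩ ⟨x₂, hx₂, hzx₂⟩
  by_cases hX₁ : ∃ x ∈ X, G.Adj z₁ x <;> by_cases hX₂ : ∃ x ∈ X, G.Adj z₂ x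
  · obtain ⟨x, hx, x', hx', h⟩ := hX z₁ h₁ z₂ h₂ (fun h => hz₁ (mem_insert_of_mem h))
      (fun h => hz₂ (mem_insert_of_mem h)) hne hn hX₁ hX₂
    exact ⟨x, mem_insert_of_mem hx, x', mem_insert_of_mem hx', h⟩
  · obtain rfl : x₂ = y := (mem_insert.1 hx₂).resolve_right fun h => hX₂ ⟨x₂, h, hzx₂⟩
    exact key z₁ h₁ z₂ h₂ hz₁ hn hX₁ hX₂ hzx₂
  · obtain rfl : x₁ = y := (mem_insert.1 hx₁).resolve_right fun h => hX₁ ⟨x₁, h, hzx₁⟩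
    obtain ⟨x, hx, x', hx', h, h', h''⟩ :=
      key z₂ h₂ z₁ h₁ hz₂ (fun h => hn h.symm) hX₂ hX₁ hzx₁
    exact ⟨x', hx', x, hx, h', h, h''.imp Eq.symm SimpleGraph.Adj.symm⟩
  · obtain rfl : x₁ = y := (mem_insert.1 hx₁).resolve_right fun h => hX₁ ⟨x₁, h, hzx₁⟩
    obtain rfl : x₂ = x₁ := (mem_insert.1 hx₂).resolve_right fun h => hX₂ ⟨x₂, h, hzx₂⟩
    exact ⟨x₂, mem_insert_self _ _, x₂, mem_insert_self _ _, hzx₁, hzx₂, .inl rfl⟩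

/-- If `W` is no clique and contains no induced five-cycle, it has a proper nonempty subset `R`
whose neighbourhood is a clique complete to `R`. -/
theorem exists_isCliqueModule_of_not_clique (hP : P5Free G) (hC : C4Free G) {W : Finset V}
    (hC5 : ¬ ∃ c : ZMod 5 → V, IsC5 G c ∧ ∀ i, c i ∈ W)
    (hW : ∃ u ∈ W, ∃ v ∈ W, u ≠ v ∧ ¬ G.Adj u v) :
    ∃ R Y : Finset V, R.Nonempty ∧ R ≠ W ∧ IsCliqueModule G W R Y := by
  classical
  let R : Finset V → Finset V := fun X => W.filter fun v => v ∉ X ∧ ∀ x ∈ X, ¬ G.Adj v x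
  let S := W.powerset.filter fun X => X.Nonempty ∧ ShortLinked G W X ∧ (R X).Nonempty
  have hS : S.Nonempty := by
    obtain ⟨u, hu, v, hv, hne, hn⟩ := hW
    refine ⟨{u}, mem_filter.2 ⟨by simpa using hu, by simp, ?_, v, ?_⟩⟩
    · intro y _ z _ _ _ _ _ h₁ h₂
      refine ⟨u, by simp, u, by simp, by simpa using h₁, by simpa using h₂, .inl rfl⟩
    · exact mem_filter.2 ⟨hv, by simpa using hne.symm, by simpa using fun h => hn h.symm⟩
  -- For a largest short-linked `X` with `R X` nonempty, a neighbour `y` of `X` missing some `r ∈ R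
  -- X` could be added to `X`, since `r` stays in the remainder.
  obtain ⟨X, hXS, hmax⟩ := S.exists_max_image card hS
  obtain ⟨hXW, ⟨x₀, hx₀⟩, hlink, hR⟩ := mem_filter.1 hXS
  rw [mem_powerset] at hXW
  let Y := W.filter fun v => v ∉ X ∧ ∃ x ∈ X, G.Adj v x
  have hcomp : ∀ y ∈ Y, ∀ r ∈ R X, G.Adj y r := by
    intro y hy r hr
    obtain ⟨hyW, hyX, hyx⟩ := mem_filter.1 hy
    obtain ⟨hrW, hrX, hrx⟩ := mem_filter.1 hr
    by_contra hn
    have hmem : insert y X ∈ S := by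
      refine mem_filter.2 ⟨mem_powerset.2 (insert_subset hyW hXW), insert_nonempty _ _,
        hlink.insert_vertex hP hyW hyX hyx, r, mem_filter.2 ⟨hrW, ?_, ?_⟩⟩
      · rw [mem_insert, not_or]
        refine ⟨?_, hrX⟩
        rintro rfl
        obtain ⟨x, hx, h⟩ := hyx
        exact hrx x hx h
      · intro x hx h
        rcases mem_insert.1 hx with rfl | hx
        · exact hn h.symm
        · exact hrx x hx h
    have := hmax _ hmem
    rw [card_insert_of_notMem hyX] at this
    omega
  refine ⟨R X, Y, hR, ?_, filter_subset _ _, ?_, ?_, hcomp, ?_⟩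
  · intro h
    exact (mem_filter.1 (h ▸ hXW hx₀ : x₀ ∈ R X)).2.1 hx₀
  · intro y hy
    obtain ⟨hyW, hyX, x, hx, h⟩ := mem_filter.1 hy
    exact mem_sdiff.2 ⟨hyW, fun hyR => (mem_filter.1 hyR).2.2 x hx h⟩
  · intro y hy z hz hne
    by_contra hn
    obtain ⟨r, hr⟩ := hR
    have hyr := hcomp y hy r hr
    have hzr := hcomp z hz r hr
    obtain ⟨hyW, hyX, hyx⟩ := mem_filter.1 hy
    obtain ⟨hzW, hzX, hzx⟩ := mem_filter.1 hz
    obtain ⟨hrW, hrX, hrx⟩ := mem_filter.1 hr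
    obtain ⟨x, hx, x', hx', h₁, h₂, h⟩ := hlink y hyW z hzW hyX hzX hne hn hyx hzx
    have hcommon : ∀ a ∈ X, G.Adj y a → G.Adj z a → False := by
      intro a ha hya hza
      refine hC y a z r hya hza.symm hzr hyr.symm hne ?_ hn (fun h => hrx a ha h.symm)
      rintro rfl
      exact hrX ha
    rcases h with rfl | h
    · exact hcommon x hx h₁ h₂
    have hzx : ¬ G.Adj z x := fun h => hcommon x hx h₁ h
    have hyx' : ¬ G.Adj y x' := fun h => hcommon x' hx' h h₂
    -- Nonadjacent `y`, `z` share the neighbour `r`, so a common neighbour in `X` gives a C₄ and a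
    -- link along an edge gives this C₅.
    refine hC5 ⟨(![y, x, x', z, r] : Fin 5 → V), ?_, ?_⟩
    · have hrx₁ := hrx x hx
      have hrx₂ := hrx x' hx'
      intro i
      change Fin 5 at i
      fin_cases i
      · exact ⟨h₁, hyx'⟩
      · exact ⟨h, fun h => hzx h.symm⟩
      · exact ⟨h₂.symm, fun h => hrx₂ h.symm⟩
      · exact ⟨hzr, fun h => hn h.symm⟩
      · exact ⟨hyr.symm, hrx₁⟩
    · intro i
      change Fin 5 at i
      fin_cases i
      exacts [hyW, hXW hx, hXW hx', hzW, hrW]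
  · intro r hr w hw hwR hrw
    obtain ⟨hrW, hrX, hrx⟩ := mem_filter.1 hr
    have hwX : w ∉ X := fun h => hrx w h hrw
    refine mem_filter.2 ⟨hw, hwX, ?_⟩
    by_contra! hcon
    exact hwR (mem_filter.2 ⟨hw, hwX, hcon⟩)

/-! ### Existence of the module and the main induction. -/

/-- Since `Y` is complete to `R`, it is complete to both `M` and `B`, so `B ∪ Y` is again a clique.
-/
theorem IsCliqueModule.trans {W R Y M B : Finset V} (hR : IsCliqueModule G W R Y)
    (hM : IsCliqueModule G R M B) : IsCliqueModule G W M (B ∪ Y) where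
  subset := hM.subset.trans hR.subset
  subset_sdiff := by
    intro v hv
    rcases mem_union.1 hv with hv | hv
    · obtain ⟨h, h'⟩ := mem_sdiff.1 (hM.subset_sdiff hv)
      exact mem_sdiff.2 ⟨hR.subset h, h'⟩
    · obtain ⟨h, h'⟩ := mem_sdiff.1 (hR.subset_sdiff hv)
      exact mem_sdiff.2 ⟨h, fun h => h' (hM.subset h)⟩
  clique := by
    intro u hu v hv hne
    rcases mem_union.1 hu with hu | hu <;> rcases mem_union.1 hv with hv | hv
    · exact hM.clique u hu v hv hne
    · exact (hR.complete v hv u (hM.mem_left hu)).symm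
    · exact hR.complete u hu v (hM.mem_left hv)
    · exact hR.clique u hu v hv hne
  complete := by
    intro u hu v hv
    rcases mem_union.1 hu with hu | hu
    · exact hM.complete u hu v hv
    · exact hR.complete u hu v (hM.subset hv)
  mem_of_adj := by
    intro u hu v hv hvM huv
    by_cases hvR : v ∈ R
    · exact mem_union_left _ (hM.mem_of_adj u hu v hvR hvM huv)
    · exact mem_union_right _ (hR.mem_of_adj u (hM.subset hu) v hv hvR huv)

theorem exists_isCliqueModule (hP : P5Free G) (hC : C4Free G) (W : Finset V)
    (hne : W.Nonempty) :
    ∃ M B : Finset V, M.Nonempty ∧ NoIndepTriple G M ∧ IsCliqueModule G W M B := by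
  induction W using Finset.strongInduction with
  | H W ih =>
  by_cases hC5 : ∃ c : ZMod 5 → V, IsC5 G c ∧ ∀ i, c i ∈ W
  · obtain ⟨c, hc, hcW⟩ := hC5
    exact hc.exists_isCliqueModule hP hC hcW
  by_cases hW : ∃ u ∈ W, ∃ v ∈ W, u ≠ v ∧ ¬ G.Adj u v
  · obtain ⟨R, Y, hR, hRW, hmod⟩ := exists_isCliqueModule_of_not_clique hP hC hC5 hW
    obtain ⟨M, B, hM, hind, hMod⟩ := ih R (hmod.subset.ssubset_of_ne hRW) hR
    exact ⟨M, B ∪ Y, hM, hind, hmod.trans hMod⟩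
  · push Not at hW
    exact ⟨W, ∅, hne, fun x hx y hy _ _ hxy _ _ => .inl (hW x hx y hy hxy), Subset.rfl,
      by simp, by simp, by simp, fun _ _ v hv hv' => absurd hv hv'⟩

theorem mix_of_colourableLT (hP : P5Free G) (hC : C4Free G) (W : Finset V) (K : Finset C)
    (hcol : ColourableLT C G W #K) : Mix G W K := by
  induction W using Finset.strongInduction with
  | H W ih =>
  rcases W.eq_empty_or_nonempty with rfl | hne
  · intro f g _ _ h
    have : f = g := funext fun v => h v (by simp)
    exact this ▸ .refl
  obtain ⟨M, B, hM, hind, hmod⟩ := exists_isCliqueModule hP hC W hne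
  refine hmod.mix (fun K' _ hK' => mix_of_noIndepTriple hind (hmod.colourableLT hcol hK'))
    (ih _ (sdiff_ssubset hmod.subset hM) ?_) hcol
  obtain ⟨f, hf, hlt⟩ := hcol
  exact ⟨f, fun u hu v hv => hf u (sdiff_subset hu) v (sdiff_subset hv),
    (card_le_card (image_subset_image sdiff_subset)).trans_lt hlt⟩

/-! ### Translation to induced subgraphs and the reconfiguration graph. -/

theorem p5Free_of_isInducedFree (h : IsInducedFree (SimpleGraph.pathGraph 5) G) : P5Free G := by
  intro a b c d e hab hbc hcd hde hac had hae hbd hbe hce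
  have hadj : ∀ i j : Fin 5, G.Adj (![a, b, c, d, e] i) (![a, b, c, d, e] j) ↔
      (SimpleGraph.pathGraph 5).Adj i j := by
    intro i j
    rw [SimpleGraph.pathGraph_adj]
    fin_cases i <;> fin_cases j <;> simp [*, G.adj_comm]
  refine h ⟨⟨⟨![a, b, c, d, e], ?_⟩, hadj _ _⟩⟩
  intro i j hij
  -- Injectivity holds because distinct vertices of P₅ have distinct neighbourhoods.
  have hnbr : ∀ k, (SimpleGraph.pathGraph 5).Adj i k ↔ (SimpleGraph.pathGraph 5).Adj j k :=
    fun k => by rw [← hadj, ← hadj, hij]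
  simp only [SimpleGraph.pathGraph_adj] at hnbr
  clear hij hadj
  revert i j
  decide

theorem c4Free_of_isInducedFree (h : IsInducedFree (SimpleGraph.cycleGraph 4) G) : C4Free G := by
  intro a b c d hab hbc hcd hda hac hbd hac' hbd'
  have hadj : ∀ i j : Fin 4, G.Adj (![a, b, c, d] i) (![a, b, c, d] j) ↔
      (SimpleGraph.cycleGraph 4).Adj i j := by
    intro i j
    have hval : (SimpleGraph.cycleGraph 4).Adj i j ↔
        (i.val + 1) % 4 = j.val ∨ (j.val + 1) % 4 = i.val := by
      rw [SimpleGraph.cycleGraph_adj]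
      clear * - i j
      revert i j
      decide
    have had := hda.symm
    rw [hval]
    fin_cases i <;> fin_cases j <;> simp [*, G.adj_comm]
  refine h ⟨⟨⟨![a, b, c, d], ?_⟩, hadj _ _⟩⟩
  intro i j hij
  -- Opposite vertices of C₄ have equal neighbourhoods, so `a ≠ c` and `b ≠ d` are needed here.
  fin_cases i <;> fin_cases j <;> simp_all

theorem coloring_ext {l : ℕ} {α β : G.Coloring (Fin l)} (h : ∀ v, α v = β v) : α = β :=
  RelHom.ext h

theorem exists_reachable_of_reach [Fintype V] {l : ℕ} {K : Finset (Fin l)}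
    (α : G.Coloring (Fin l)) {f : V → Fin l} (h : Reach G univ K α f) :
    ∃ β : G.Coloring (Fin l), (∀ v, β v = f v) ∧ (reconfigurationGraph G l).Reachable α β := by
  induction h with
  | refl => exact ⟨α, fun _ => rfl, .rfl⟩
  | @tail b c _ hs ih =>
    obtain ⟨β, hβ, hαβ⟩ := ih
    obtain ⟨_, hc, v, _, q, rfl⟩ := hs
    let γ : G.Coloring (Fin l) := SimpleGraph.Coloring.mk (update b v q)
      fun {u w} huw => hc.2 u (mem_univ u) w (mem_univ w) huw
    have hγ : ∀ w, γ w = update b v q w := fun _ => rfl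
    refine ⟨γ, hγ, hαβ.trans ?_⟩
    -- A `Step` may leave the colour unchanged, in which case it is no edge.
    by_cases hq : b v = q
    · have : β = γ := coloring_ext fun w => by rw [hγ, ← hq, update_eq_self, hβ]
      exact this ▸ .rfl
    · refine SimpleGraph.Adj.reachable ⟨v, by simpa [hγ, hβ] using hq, fun w hw => ?_⟩
      by_contra hne
      exact hw (by rw [hγ, update_of_ne hne, hβ])

end Recolour

open Recolour Finset in
theorem theorem8 {V : Type*} [Finite V] (G : SimpleGraph V)
    (hP5 : IsInducedFree (SimpleGraph.pathGraph 5) G)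
    (hC4 : IsInducedFree (SimpleGraph.cycleGraph 4) G)
    (l : ℕ) (hl : G.chromaticNumber + 1 ≤ (l : ℕ∞)) :
    IsMixing G l := by
  classical
  have := Fintype.ofFinite V
  obtain ⟨k, rfl⟩ : ∃ k, l = k + 1 := by
    refine Nat.exists_eq_succ_of_ne_zero ?_
    rintro rfl
    simp at hl
  have hk : G.Colorable k := by
    rw [← SimpleGraph.chromaticNumber_le_iff_colorable]
    push_cast at hl
    exact (ENat.add_le_add_iff_right ENat.one_ne_top).1 hl
  obtain ⟨γ⟩ := hk
  have hcol : ColourableLT (Fin (k + 1)) G univ #(univ : Finset (Fin (k + 1))) := by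
    refine ⟨fun v => (γ v).castSucc, fun u _ v _ huv h =>
      γ.valid huv (Fin.castSucc_injective k h), ?_⟩
    -- The embedded `k`-colouring never uses the last of the `k + 1` colours.
    refine card_lt_card ((ssubset_univ_iff).2 fun h => ?_)
    obtain ⟨v, -, hv⟩ := mem_image.1 (h ▸ mem_univ (Fin.last k))
    exact Fin.castSucc_ne_last _ hv
  have hmix := mix_of_colourableLT (p5Free_of_isInducedFree hP5) (c4Free_of_isInducedFree hC4)
    univ univ hcol
  have hproper : ∀ α : G.Coloring (Fin (k + 1)), Proper G univ univ α := fun α =>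
    ⟨fun v _ => mem_univ _, fun u _ v _ huv => α.valid huv⟩
  refine @SimpleGraph.Connected.mk _ _ (fun α β => ?_)
    ⟨SimpleGraph.Coloring.mk (fun v => (γ v).castSucc) fun {u v} huv h =>
      γ.valid huv (Fin.castSucc_injective k h)⟩
  obtain ⟨β', hβ', h⟩ := exists_reachable_of_reach α
    (hmix α β (hproper α) (hproper β) fun v hv => absurd (mem_univ v) hv)
  exact coloring_ext hβ' ▸ h
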